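/- Equip the category $\mathrm{SmCat}$ of small categories with the Joyal–Tierney model structure: weak equivalences are the equivalences of categories, cofibrations are the functors injective on objects, fibrations are the isofibrations. Write $1$ for the terminal object. Call $W$ a homotopy pushout of $Y\leftarrow X\to Z$ if $W$ is the pushout of a span of cofibrations $\tilde Y\leftarrow\tilde X\to\tilde Z$ with $\tilde X$ cofibrant, mapping to the given span by acyclic fibrations $\tilde X\to X$, $\tilde Y\to Y$, $\tilde Z\to Z$. For $X$ cofibrant, call $W$ a one-sided homotopy pushout of $f:X\to Z$ along $g:X\to Y$ if $g$ factors as a cofibration $X\to\tilde Y$ followed by an acyclic fibration $\tilde Y\to Y$ and $W$ is the pushout of $\tilde Y\leftarrow X\xrightarrow{f} Z$. The $0$-sphere is $1\amalg 1$; for $n\ge 1$ an $n$-sphere is a homotopy pushout of $1\leftarrow Y\to 1$ with $Y$ an $(n-1)$-sphere. A $0$-dimensional CW-complex is a cofibrant object that is a coproduct of copies of $1$; for $n\ge1$ an $n$-dimensional CW-complex is a one-sided homotopy pushout $X$ of a map $\coprod_{i\in I}S_i\to Y$ along $\coprod_{i\in I}S_i\to\coprod_{i\in I}1$, where $I$ is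 a set, each $S_i$ is an $(n-1)$-sphere and $Y$ is an $(n-1)$-dimensional CW-complex; the map $Y\to X$ is then called an $(n-1)$-skeleton inclusion. A finite-dimensional CW-complex is an $n$-dimensional one for some $n\ge 0$. A CW-complex is a cofibrant object weakly equivalent to the colimit of a sequence $X_0\to X_1\to X_2\to\cdots$ in which each $X_n$ is an $n$-dimensional CW-complex and each $X_n\to X_{n+1}$ is an $n$-skeleton inclusion. Two objects are weakly equivalent if they are joined by a zigzag of weak equivalences. Theorem. 1. A small category is weakly equivalent to a CW-complex if and only if it is a groupoid; likewise, it is weakly equivalent to a finite-dimensional CW-complex if and only if it is a groupoid. 2. Every CW-complex, and every finite-dimensional CW-complex, in $\mathrm{SmCat}$ is weakly equivalent to a $2$-dimensional CW-complex. 3. For every $n\ge 2$, $n$-spheres exist in $\mathrm{SmCat}$, and every $n$-sphere is contractible, i.e. weakly equivalent to $1$. -/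

import Mathlib

open CategoryTheory CategoryTheory.Limits HomotopicalAlgebra

universe v u

namespace FormalCW

section General

variable {C : Type u} [Category.{v} C]

/-- Two objects are weakly equivalent if they are joined by a finite zigzag of weak
equivalences. -/
def WeaklyEquivalent [CategoryWithWeakEquivalences C] (X Y : C) : Prop :=
  Relation.EqvGen (fun A B : C => ∃ f : A ⟶ B, WeakEquivalence f) X Y

variable [CategoryWithCofibrations C] [CategoryWithFibrations C]
  [CategoryWithWeakEquivalences C] [HasTerminal C] [HasColimits C]

/-- `W` is a homotopy pushout of the span `Y ⟵g⟵ X ⟶f⟶ Z`: it is the strict pushout of a span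
`Y' ⟵ X' ⟶ Z'` of cofibrations with `X'` cofibrant, which maps to the given span by acyclic
fibrations. -/
def IsHomotopyPushout {X Y Z : C} (f : X ⟶ Z) (g : X ⟶ Y) (W : C) : Prop :=
  ∃ (X' Y' Z' : C) (f' : X' ⟶ Z') (g' : X' ⟶ Y') (pX : X' ⟶ X) (pY : Y' ⟶ Y) (pZ : Z' ⟶ Z)
    (k : Z' ⟶ W) (l : Y' ⟶ W),
    IsCofibrant X' ∧ Cofibration f' ∧ Cofibration g' ∧
    (Fibration pX ∧ WeakEquivalence pX) ∧
    (Fibration pY ∧ WeakEquivalence pY) ∧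
    (Fibration pZ ∧ WeakEquivalence pZ) ∧
    f' ≫ pZ = pX ≫ f ∧ g' ≫ pY = pX ≫ g ∧
    IsPushout f' g' k l

/-- `W` is a one-sided homotopy pushout of `f : X ⟶ Z` along `g : X ⟶ Y`, with canonical map
`j : Z ⟶ W`: the object `X` is cofibrant, `g` factors as a cofibration `X ⟶ Y'` followed by an
acyclic fibration `Y' ⟶ Y`, and `W` is the strict pushout of `Y' ⟵ X ⟶ Z`. -/
def IsOneSidedHomotopyPushout {X Y Z W : C} (f : X ⟶ Z) (g : X ⟶ Y) (j : Z ⟶ W) : Prop :=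
  IsCofibrant X ∧
  ∃ (Y' : C) (i : X ⟶ Y') (p : Y' ⟶ Y) (l : Y' ⟶ W),
    Cofibration i ∧ (Fibration p ∧ WeakEquivalence p) ∧ i ≫ p = g ∧ IsPushout f i j l

/-- `X` is an `n`-sphere: the `0`-sphere is the coproduct of two copies of the terminal object,
and an `(n + 1)`-sphere is a homotopy pushout of `1 ⟵ Y ⟶ 1` with `Y` an `n`-sphere. -/
def IsSphere : ℕ → C → Prop
  | 0, X => Nonempty (X ≅ (⊤_ C) ⨿ (⊤_ C))
  | n + 1, X => ∃ Y : C, IsSphere n Y ∧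
      IsHomotopyPushout (terminal.from Y) (terminal.from Y) X

/-- The map `j : Y ⟶ X` attaches `(n + 1)`-cells to `Y`: it is the canonical map into a one-sided
homotopy pushout of a map `∐ S i ⟶ Y` out of a coproduct of `n`-spheres along
`∐ S i ⟶ ∐ 1`. -/
def AttachesCells (n : ℕ) {Y X : C} (j : Y ⟶ X) : Prop :=
  ∃ (I : Type v) (S : I → C) (f : (∐ S) ⟶ Y), (∀ i, IsSphere n (S i)) ∧
    IsOneSidedHomotopyPushout f
      (Limits.Sigma.map (g := fun _ : I => ⊤_ C) fun i => terminal.from (S i)) j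

/-- `X` is an `n`-dimensional CW-complex. -/
def IsCWComplexOfDim : ℕ → C → Prop
  | 0, X => IsCofibrant X ∧ ∃ I : Type v, Nonempty (X ≅ ∐ fun _ : I => ⊤_ C)
  | n + 1, X => ∃ (Y : C) (j : Y ⟶ X), IsCWComplexOfDim n Y ∧ AttachesCells n j

/-- `j : Y ⟶ X` is an `n`-skeleton inclusion. -/
def IsSkeletonInclusion (n : ℕ) {Y X : C} (j : Y ⟶ X) : Prop :=
  IsCWComplexOfDim n Y ∧ AttachesCells n j

/-- `X` is a finite-dimensional CW-complex. -/
def IsFiniteDimCWComplex (X : C) : Prop := ∃ n, IsCWComplexOfDim n X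

/-- `X` is a CW-complex, of possibly infinite dimension: `X` is cofibrant and weakly equivalent to
the colimit of a sequence `X₀ ⟶ X₁ ⟶ X₂ ⟶ ⋯` in which `Xₙ` is an `n`-dimensional CW-complex and
`Xₙ ⟶ Xₙ₊₁` is an `n`-skeleton inclusion. -/
def IsCWComplex (X : C) : Prop :=
  IsCofibrant X ∧ ∃ F : ℕ ⥤ C,
    (∀ n, IsCWComplexOfDim n (F.obj n)) ∧
    (∀ n, IsSkeletonInclusion n (F.map (homOfLE (Nat.le_succ n)))) ∧
    WeaklyEquivalent X (colimit F)

end General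

/-- A functor is an isofibration if every isomorphism `F X ≅ Y` lifts to an isomorphism
`X ≅ Y'`. -/
def IsIsofibration {A B : Type*} [Category A] [Category B] (F : A ⥤ B) : Prop :=
  ∀ (X : A) (Y : B) (e : F.obj X ≅ Y), ∃ (Y' : A) (e' : X ≅ Y') (h : F.obj Y' = Y),
    F.map e'.hom ≫ eqToHom h = e.hom

/-! The three classes of maps of the Joyal–Tierney model structure on small categories. -/

/-- The cofibrations are the functors that are injective on objects. -/
instance joyalTierneyCofibrations : CategoryWithCofibrations Cat.{u, u} where
  cofibrations _ _ F := Function.Injective F.toFunctor.obj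

/-- The fibrations are the isofibrations. -/
instance joyalTierneyFibrations : CategoryWithFibrations Cat.{u, u} where
  fibrations _ _ F := IsIsofibration F.toFunctor

/-- The weak equivalences are the equivalences of categories. -/
instance joyalTierneyWeakEquivalences : CategoryWithWeakEquivalences Cat.{u, u} where
  weakEquivalences _ _ F := F.toFunctor.IsEquivalence

end FormalCW

/-! The point and its coproducts are groupoids, anything equivalent to a groupoid is one, and a
colimit in `Cat` of groupoids is a groupoid (`isGroupoid_of_isColimit`): it coincides with its own
core. Hence all spheres and CW-complexes are groupoids, which gives one direction of both
equivalences.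

Conversely, a groupoid `X` is itself a 2-dimensional CW-complex, by generators and relations. Its
0-skeleton is the discrete category on its objects; one edge for each morphism gives the free
groupoid `FreeOn X`; one 2-cell for each parallel pair with equal image in `X` imposes all relations
(`isPushout_evaluation`). The walking isomorphism serves as the cell, with the same two objects as
the chosen models of the 0- and 1-sphere, so attaching creates or identifies no objects and the
result is `X` on the nose, not merely up to equivalence. Empty families of cells continue the
skeleta as a constant sequence, so `X` is also a CW-complex in the infinite sense.

A sphere of dimension at least 2 is a pushout of two contractible groupoids along a connected one.
As in van Kampen's theorem, such a pushout is contractible (`IsPushout.subsingleton_hom`). -/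

namespace FormalCW

/-! ### The chaotic category on a type -/

/-- The category with objects `A` and exactly one morphism between any two objects. -/
structure Chaotic (A : Type u) : Type u where
  /-- The underlying element. -/
  as : A

instance (A : Type u) : Category.{u} (Chaotic A) where
  Hom _ _ := PUnit
  id _ := ⟨⟩
  comp _ _ := ⟨⟩

/-- The functor to a chaotic category given by a map on objects. -/
def Chaotic.functor {C : Type u} [Category.{u} C] {A : Type u} (f : C → A) : C ⥤ Chaotic A where
  obj x := ⟨f x⟩
  map _ := ⟨⟩

/-- The chaotic category as a functor to `Cat`. -/
def chaoticCat : Type u ⥤ Cat.{u, u} where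
  obj A := Cat.of (Chaotic A)
  map f := (Chaotic.functor fun x => f x.as).toCatHom

/-- The chaotic category is right adjoint to the functor of objects. -/
def objectsAdjChaotic : Cat.objects.{u, u} ⊣ chaoticCat.{u} :=
  Adjunction.mkOfHomEquiv
    { homEquiv _ _ := TypeCat.homEquiv.trans
        { toFun f := (Chaotic.functor f).toCatHom
          invFun F x := (F.toFunctor.obj x).as
          left_inv _ := rfl
          right_inv _ := rfl }
      homEquiv_naturality_left_symm _ _ := rfl
      homEquiv_naturality_right _ _ := rfl }

instance : Cat.objects.{u, u}.IsLeftAdjoint := objectsAdjChaotic.isLeftAdjoint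

/-! ### Bijectivity on objects and pushouts -/

lemma isIso_objects_map_iff {A B : Cat.{u, u}} (F : A ⟶ B) :
    IsIso (Cat.objects.map F) ↔ Function.Bijective F.toFunctor.obj :=
  isIso_iff_bijective _

/-- The functor of objects is a left adjoint, so it sends the square to a pushout of sets, where
isomorphisms are stable under cobase change. -/
lemma _root_.CategoryTheory.IsPushout.bijective_obj {A B C D : Cat.{u, u}} {f : A ⟶ B}
    {g : A ⟶ C} {k : B ⟶ D} {l : C ⟶ D} (h : IsPushout f g k l) (hg : Function.Bijective g.toFunctor.obj) :
    Function.Bijective k.toFunctor.obj := by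
  rw [← isIso_objects_map_iff] at hg ⊢
  exact (h.map Cat.objects).isIso_inl_of_isIso hg

lemma _root_.CategoryTheory.IsPushout.obj_cases {A B C D : Cat.{u, u}} {f : A ⟶ B}
    {g : A ⟶ C} {k : B ⟶ D} {l : C ⟶ D} (h : IsPushout f g k l) (d : D) :
    (∃ b, k.toFunctor.obj b = d) ∨ ∃ c, l.toFunctor.obj c = d := by
  rcases Limits.Types.eq_or_eq_of_isPushout (h.map Cat.objects) d with ⟨b, hb⟩ | ⟨c, hc⟩
  · exact Or.inl ⟨b, hb⟩
  · exact Or.inr ⟨c, hc⟩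

lemma bijective_obj_of_isIso {A B : Cat.{u, u}} (F : A ⟶ B) [IsIso F] :
    Function.Bijective F.toFunctor.obj := by
  rw [← isIso_objects_map_iff]; infer_instance

lemma isEmpty_initial : IsEmpty (⊥_ Cat.{u, u}) := by
  by_contra h
  rw [not_isEmpty_iff] at h
  exact ((initial.to (Cat.of (Discrete PEmpty.{u + 1}))).toFunctor.obj h.some).as.elim

/-! ### The Joyal–Tierney classes -/

lemma cofibration_iff_injective {A B : Cat.{u, u}} (F : A ⟶ B) :
    Cofibration F ↔ Function.Injective F.toFunctor.obj :=
  cofibration_iff F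

lemma fibration_iff_isIsofibration {A B : Cat.{u, u}} (F : A ⟶ B) :
    Fibration F ↔ IsIsofibration F.toFunctor :=
  fibration_iff F

lemma weakEquivalence_iff_isEquivalence {A B : Cat.{u, u}} (F : A ⟶ B) :
    WeakEquivalence F ↔ F.toFunctor.IsEquivalence :=
  weakEquivalence_iff F

/-- The initial category is empty, so injectivity on objects is vacuous and the cofibrancy
conditions cost nothing. -/
lemma isCofibrant (X : Cat.{u, u}) : IsCofibrant X := by
  rw [isCofibrant_iff, cofibration_iff_injective]
  intro x
  exact isEmpty_initial.elim x

/-- A functor that is full, faithful and surjective on objects. -/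
structure IsSurjectiveEquivalence {A B : Cat.{u, u}} (F : A ⟶ B) : Prop where
  full : F.toFunctor.Full
  faithful : F.toFunctor.Faithful
  surjective : Function.Surjective F.toFunctor.obj

lemma IsSurjectiveEquivalence.acyclicFibration {A B : Cat.{u, u}} {F : A ⟶ B}
    (h : IsSurjectiveEquivalence F) : Fibration F ∧ WeakEquivalence F := by
  have := h.full
  have := h.faithful
  rw [fibration_iff_isIsofibration, weakEquivalence_iff_isEquivalence]
  refine ⟨fun X Y e => ?_, ⟨inferInstance, inferInstance, ⟨fun Y => ?_⟩⟩⟩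
  · obtain ⟨Y, rfl⟩ := h.surjective Y
    exact ⟨Y, F.toFunctor.preimageIso e, rfl, by simp⟩
  · obtain ⟨X, rfl⟩ := h.surjective Y
    exact ⟨X, ⟨Iso.refl _⟩⟩

lemma IsSurjectiveEquivalence.comp {A B C : Cat.{u, u}} {F : A ⟶ B} {G : B ⟶ C}
    (hF : IsSurjectiveEquivalence F) (hG : IsSurjectiveEquivalence G) :
    IsSurjectiveEquivalence (F ≫ G) := by
  have := hF.full
  have := hF.faithful
  have := hG.full
  have := hG.faithful
  exact ⟨inferInstanceAs (F.toFunctor ⋙ G.toFunctor).Full,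
    inferInstanceAs (F.toFunctor ⋙ G.toFunctor).Faithful, hG.surjective.comp hF.surjective⟩

lemma isEquivalence_of_isIso {A B : Cat.{u, u}} (F : A ⟶ B) [IsIso F] :
    F.toFunctor.IsEquivalence :=
  inferInstanceAs (Cat.equivOfIso (asIso F)).functor.IsEquivalence

lemma isSurjectiveEquivalence_of_isIso {A B : Cat.{u, u}} (F : A ⟶ B) [IsIso F] :
    IsSurjectiveEquivalence F :=
  have := isEquivalence_of_isIso F
  ⟨inferInstance, inferInstance, (bijective_obj_of_isIso F).2⟩

lemma weakEquivalence_of_isIso {A B : Cat.{u, u}} (F : A ⟶ B) [IsIso F] : WeakEquivalence F :=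
  (weakEquivalence_iff_isEquivalence F).2 (isEquivalence_of_isIso F)

/-! ### Functors to the terminal category -/

/-- The terminal category is the discrete category on one object. -/
noncomputable def terminalIso : (⊤_ Cat.{u, u}) ≅ Cat.of (Discrete PUnit.{u + 1}) :=
  terminalIsoIsTerminal Cat.isTerminalDiscretePUnit

lemma subsingleton_hom_terminal (x y : (⊤_ Cat.{u, u} : Cat.{u, u})) : Subsingleton (x ⟶ y) :=
  have := isEquivalence_of_isIso terminalIso.{u}.hom
  ⟨fun _ _ => terminalIso.{u}.hom.toFunctor.map_injective
    (Subsingleton.elim (α := ULift (PLift (PUnit.unit = PUnit.unit))) _ _)⟩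

lemma subsingleton_terminal : Subsingleton (⊤_ Cat.{u, u} : Cat.{u, u}) :=
  ⟨fun _ _ => (bijective_obj_of_isIso terminalIso.{u}.hom).1
    (Subsingleton.elim (α := Discrete PUnit) _ _)⟩

lemma nonempty_terminal : Nonempty (⊤_ Cat.{u, u} : Cat.{u, u}) :=
  ⟨terminalIso.{u}.inv.toFunctor.obj (Discrete.mk PUnit.unit)⟩

/-- A nonempty category with exactly one morphism between any two objects is an acyclic fibration
over the terminal category. -/
lemma isSurjectiveEquivalence_terminal_from {A : Cat.{u, u}} [Nonempty A]
    (h : ∀ x y : A, Nonempty (x ⟶ y)) (h' : ∀ x y : A, Subsingleton (x ⟶ y))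
    (F : A ⟶ ⊤_ Cat.{u, u}) : IsSurjectiveEquivalence F where
  full := ⟨fun {x y} _ => ⟨(h x y).some, (subsingleton_hom_terminal _ _).elim _ _⟩⟩
  faithful := ⟨fun {x y} _ _ _ => (h' x y).elim _ _⟩
  surjective _ := ⟨Classical.arbitrary A, subsingleton_terminal.elim _ _⟩

lemma unique_hom_of_weakEquivalence_terminal {A : Cat.{u, u}} {F : A ⟶ ⊤_ Cat.{u, u}}
    (h : WeakEquivalence F) :
    (∀ x y : A, Nonempty (x ⟶ y)) ∧ ∀ x y : A, Subsingleton (x ⟶ y) := by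
  rw [weakEquivalence_iff_isEquivalence] at h
  refine ⟨fun x y => ?_, fun x y => ⟨fun f g => F.toFunctor.map_injective
    ((subsingleton_hom_terminal _ _).elim _ _)⟩⟩
  exact ⟨F.toFunctor.preimage (eqToHom (subsingleton_terminal.elim _ _))⟩

/-! ### Groupoids in `Cat` -/

lemma IsGroupoid.of_isEquivalence {A B : Type u} [Category.{u} A] [Category.{u} B] (F : A ⥤ B)
    [F.IsEquivalence] : IsGroupoid A ↔ IsGroupoid B :=
  ⟨fun _ => isGroupoid_of_reflects_iso F.inv, fun _ => isGroupoid_of_reflects_iso F⟩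

lemma WeaklyEquivalent.isGroupoid_iff {A B : Cat.{u, u}} (h : WeaklyEquivalent A B) :
    IsGroupoid A ↔ IsGroupoid B := by
  induction h with
  | rel A B h =>
    obtain ⟨F, hF⟩ := h
    rw [weakEquivalence_iff_isEquivalence] at hF
    exact IsGroupoid.of_isEquivalence F.toFunctor
  | refl => rfl
  | symm _ _ _ ih => exact ih.symm
  | trans _ _ _ _ _ ih₁ ih₂ => exact ih₁.trans ih₂

/-- A functor from a groupoid factors through the core. -/
noncomputable def liftCore {A B : Cat.{u, u}} [IsGroupoid A] (F : A ⟶ B) :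
    A ⟶ Cat.of (Core B) :=
  letI : Groupoid A := Groupoid.ofIsGroupoid
  (Core.functorToCore F.toFunctor).toCatHom

/-- The inclusion of the core. -/
def coreInclusion (B : Cat.{u, u}) : Cat.of (Core B) ⟶ B := (Core.inclusion B).toCatHom

instance (B : Cat.{u, u}) : Mono (coreInclusion B) where
  right_cancellation {Z} F G h := by
    have h' := congrArg Cat.Hom.toFunctor h
    apply Cat.ext
    have ho : ∀ x, F.toFunctor.obj x = G.toFunctor.obj x := fun x =>
      congrArg Core.mk (Functor.congr_obj h' x)
    -- The two functors agree on objects only propositionally, so morphisms are compared by `HEq`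
    -- with variable endpoints.
    have key : ∀ {x y x' y' : Core B} (f : x ⟶ y) (g : x' ⟶ y'), x = x' → y = y' →
        HEq f.iso.hom g.iso.hom → HEq f g := by
      rintro x y _ _ f g rfl rfl hfg
      exact heq_of_eq (Core.hom_ext (eq_of_heq hfg))
    exact Functor.hext ho fun x y f => key _ _ (ho x) (ho y) (Functor.hcongr_hom h' f)

/-- Colimits of groupoids in `Cat` are groupoids. -/
lemma isGroupoid_of_isColimit {J : Type*} [Category* J] {F : J ⥤ Cat.{u, u}} {c : Cocone F}
    (hc : IsColimit c) (h : ∀ j, IsGroupoid (F.obj j)) : IsGroupoid c.pt := by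
  -- The colimit cocone factors through the core of its point. Naturality can be checked after the
  -- core inclusion, which is a monomorphism.
  let s : Cocone F :=
    { pt := Cat.of (Core c.pt)
      ι := { app j := liftCore (c.ι.app j)
             naturality i j f := by
              rw [← cancel_mono (coreInclusion c.pt)]
              exact c.ι.naturality f } }
  -- The induced functor is a section of the core inclusion, so every morphism is the image of a
  -- morphism of the core, up to `eqToHom`.
  have hs : hc.desc s ≫ coreInclusion c.pt = 𝟙 _ :=
    hc.hom_ext fun j => by
      rw [hc.fac_assoc]
      exact (Category.comp_id _).symm
  refine ⟨fun {x y} f => ?_⟩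
  have := Functor.congr_hom (congrArg Cat.Hom.toFunctor hs.symm) f
  have hf : IsIso ((coreInclusion c.pt).toFunctor.map ((hc.desc s).toFunctor.map f)) :=
    Iso.isIso_hom ((hc.desc s).toFunctor.map f).iso
  change f = _ at this
  rw [this]
  exact @IsIso.comp_isIso _ _ _ _ _ _ _ inferInstance
    (@IsIso.comp_isIso _ _ _ _ _ _ _ hf inferInstance)

lemma _root_.CategoryTheory.IsPushout.isGroupoid {A B C D : Cat.{u, u}} {f : A ⟶ B}
    {g : A ⟶ C} {k : B ⟶ D} {l : C ⟶ D} (h : IsPushout f g k l) (hA : IsGroupoid A) (hB : IsGroupoid B)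
    (hC : IsGroupoid C) : IsGroupoid D :=
  isGroupoid_of_isColimit h.isColimit (by rintro (_ | _ | _) <;> assumption)

lemma isGroupoid_terminal : IsGroupoid (⊤_ Cat.{u, u} : Cat.{u, u}) :=
  ⟨fun _ => ⟨eqToHom (subsingleton_terminal.elim _ _),
    (subsingleton_hom_terminal _ _).elim _ _, (subsingleton_hom_terminal _ _).elim _ _⟩⟩

lemma isGroupoid_sigma {I : Type u} (F : I → Cat.{u, u}) (h : ∀ i, IsGroupoid (F i)) :
    IsGroupoid (∐ F : Cat.{u, u}) :=
  isGroupoid_of_isColimit (coproductIsCoproduct F) fun ⟨i⟩ => h i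

lemma isGroupoid_of_weakEquivalence {A B : Cat.{u, u}} {F : A ⟶ B} (h : WeakEquivalence F)
    (hB : IsGroupoid B) : IsGroupoid A := by
  rw [weakEquivalence_iff_isEquivalence] at h
  exact (IsGroupoid.of_isEquivalence F.toFunctor).2 hB

lemma isGroupoid_of_iso {A B : Cat.{u, u}} (e : A ≅ B) (hB : IsGroupoid B) : IsGroupoid A :=
  isGroupoid_of_weakEquivalence (weakEquivalence_of_isIso e.hom) hB

lemma IsSphere.isGroupoid {n : ℕ} {S : Cat.{u, u}} (h : IsSphere n S) : IsGroupoid S := by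
  induction n generalizing S with
  | zero =>
    obtain ⟨e⟩ := h
    exact isGroupoid_of_iso e (isGroupoid_of_isColimit (colimit.isColimit (pair _ _))
      (by rintro ⟨_ | _⟩ <;> exact isGroupoid_terminal))
  | succ n ih =>
    obtain ⟨Y, hY, X', Y', Z', f', g', pX, pY, pZ, k, l, -, -, -, hX, hpY, hpZ, -, -, hW⟩ := h
    exact hW.isGroupoid (isGroupoid_of_weakEquivalence hX.2 (ih hY))
      (isGroupoid_of_weakEquivalence hpZ.2 isGroupoid_terminal)
      (isGroupoid_of_weakEquivalence hpY.2 isGroupoid_terminal)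

lemma AttachesCells.isGroupoid {n : ℕ} {Y X : Cat.{u, u}} {j : Y ⟶ X} (h : AttachesCells n j)
    (hY : IsGroupoid Y) : IsGroupoid X := by
  obtain ⟨I, S, f, hS, -, Y', i, p, l, -, hp, -, hW⟩ := h
  exact hW.isGroupoid (isGroupoid_sigma S fun i => (hS i).isGroupoid) hY
    (isGroupoid_of_weakEquivalence hp.2 (isGroupoid_sigma _ fun _ => isGroupoid_terminal))

lemma IsCWComplexOfDim.isGroupoid {n : ℕ} {X : Cat.{u, u}} (h : IsCWComplexOfDim n X) :
    IsGroupoid X := by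
  induction n generalizing X with
  | zero =>
    obtain ⟨-, I, ⟨e⟩⟩ := h
    exact isGroupoid_of_iso e (isGroupoid_sigma _ fun _ => isGroupoid_terminal)
  | succ n ih =>
    obtain ⟨Y, j, hY, hj⟩ := h
    exact hj.isGroupoid (ih hY)

lemma IsCWComplex.isGroupoid {X : Cat.{u, u}} (h : IsCWComplex X) : IsGroupoid X := by
  obtain ⟨-, F, hF, -, hX⟩ := h
  exact hX.isGroupoid_iff.2
    (isGroupoid_of_isColimit (colimit.isColimit F) fun n => (hF n).isGroupoid)

/-! ### Existence and contractibility of spheres -/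

lemma isSurjectiveEquivalence_chaotic (A : Type u) [Nonempty A]
    (F : Cat.of (Chaotic A) ⟶ ⊤_ Cat.{u, u}) : IsSurjectiveEquivalence F :=
  have : Nonempty (Cat.of (Chaotic A)) := ⟨Chaotic.mk (Classical.arbitrary A)⟩
  isSurjectiveEquivalence_terminal_from
    (fun _ _ => ⟨PUnit.unit⟩)
    (fun _ _ => inferInstanceAs (Subsingleton PUnit)) F

/-- The strict pushout of two injective-on-objects functors into chaotic categories is a
suspension. -/
lemma IsSphere.succ_of_isPushout {n : ℕ} {Y W : Cat.{u, u}} (hY : IsSphere n Y) {A B : Type u}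
    [Nonempty A] [Nonempty B] {f : Y ⟶ Cat.of (Chaotic A)} {g : Y ⟶ Cat.of (Chaotic B)}
    (hf : Function.Injective f.toFunctor.obj) (hg : Function.Injective g.toFunctor.obj)
    {k : Cat.of (Chaotic A) ⟶ W} {l : Cat.of (Chaotic B) ⟶ W} (h : IsPushout f g k l) :
    IsSphere (n + 1) W :=
  ⟨Y, hY, Y, _, _, f, g, 𝟙 Y, terminal.from _, terminal.from _, k, l, isCofibrant Y,
    (cofibration_iff_injective _).2 hf, (cofibration_iff_injective _).2 hg,
    (isSurjectiveEquivalence_of_isIso _).acyclicFibration,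
    (isSurjectiveEquivalence_chaotic _ _).acyclicFibration,
    (isSurjectiveEquivalence_chaotic _ _).acyclicFibration,
    Subsingleton.elim _ _, Subsingleton.elim _ _, h⟩

lemma exists_isSphere (n : ℕ) : ∃ S : Cat.{u, u}, IsSphere n S := by
  induction n with
  | zero => exact ⟨_, ⟨Iso.refl _⟩⟩
  | succ n ih =>
    obtain ⟨Y, hY⟩ := ih
    -- `Option Y` contains `Y` injectively and is nonempty for free, so its chaotic category is a
    -- contractible cone on `Y`.
    let f : Y ⟶ Cat.of (Chaotic (Option Y)) := (Chaotic.functor some).toCatHom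
    have hf : Function.Injective f.toFunctor.obj := fun x y h =>
      Option.some_injective _ (congrArg Chaotic.as h)
    exact ⟨_, hY.succ_of_isPushout hf hf (IsPushout.of_hasPushout f f)⟩

lemma IsSphere.nonempty {n : ℕ} {S : Cat.{u, u}} (h : IsSphere n S) : Nonempty S := by
  induction n generalizing S with
  | zero =>
    obtain ⟨e⟩ := h
    exact ⟨((coprod.inl : ⊤_ Cat.{u, u} ⟶ _) ≫ e.inv).toFunctor.obj nonempty_terminal.some⟩
  | succ n ih =>
    obtain ⟨Y, hY, X', Y', Z', f', g', pX, pY, pZ, k, l, -, -, -, hX, -, -, -, -, -⟩ := h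
    have := (weakEquivalence_iff_isEquivalence _).1 hX.2
    exact ⟨(f' ≫ k).toFunctor.obj (pX.toFunctor.objPreimage (ih hY).some)⟩

/-- The pushout of strongly connected categories along a nonempty category is strongly
connected. -/
lemma _root_.CategoryTheory.IsPushout.nonempty_hom {A B C D : Cat.{u, u}} {f : A ⟶ B} {g : A ⟶ C}
    {k : B ⟶ D} {l : C ⟶ D} (h : IsPushout f g k l) (hA : Nonempty A)
    (hB : ∀ x y : B, Nonempty (x ⟶ y)) (hC : ∀ x y : C, Nonempty (x ⟶ y)) (x y : D) :
    Nonempty (x ⟶ y) := by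
  obtain ⟨a⟩ := hA
  have e : k.toFunctor.obj (f.toFunctor.obj a) = l.toFunctor.obj (g.toFunctor.obj a) :=
    Functor.congr_obj (congrArg Cat.Hom.toFunctor h.w) a
  have hx : Nonempty (x ⟶ k.toFunctor.obj (f.toFunctor.obj a)) := by
    rcases h.obj_cases x with ⟨b, rfl⟩ | ⟨c, rfl⟩
    · exact (hB _ _).map k.toFunctor.map
    · rw [e]
      exact (hC _ _).map l.toFunctor.map
  have hy : Nonempty (k.toFunctor.obj (f.toFunctor.obj a) ⟶ y) := by
    rcases h.obj_cases y with ⟨b, rfl⟩ | ⟨c, rfl⟩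
    · exact (hB _ _).map k.toFunctor.map
    · rw [e]
      exact (hC _ _).map l.toFunctor.map
  exact ⟨hx.some ≫ hy.some⟩

/-- Both glued categories are equivalent to the point and they meet in a nonempty category. This
starts in dimension 1, since the 0-sphere is disconnected. -/
lemma IsSphere.nonempty_hom {n : ℕ} {S : Cat.{u, u}} (h : IsSphere (n + 1) S) (x y : S) :
    Nonempty (x ⟶ y) := by
  obtain ⟨Y, hY, X', Y', Z', f', g', pX, pY, pZ, k, l, -, -, -, hX, hpY, hpZ, -, -, hW⟩ := h
  have := (weakEquivalence_iff_isEquivalence _).1 hX.2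
  exact hW.nonempty_hom ⟨pX.toFunctor.objPreimage hY.nonempty.some⟩
    (unique_hom_of_weakEquivalence_terminal hpZ.2).1
    (unique_hom_of_weakEquivalence_terminal hpY.2).1 x y

lemma toUnder_congr {A D : Type u} [Category.{u} A] [Category.{u} D] {F G : A ⥤ D} (e : F = G)
    (d : D) (s : ∀ a, d ⟶ F.obj a) (hs : ∀ {a b : A} (m : a ⟶ b), s a ≫ F.map m = s b)
    (t : ∀ a, d ⟶ G.obj a) (ht : ∀ {a b : A} (m : a ⟶ b), t a ≫ G.map m = t b)
    (h : ∀ a, s a ≫ eqToHom (Functor.congr_obj e a) = t a) :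
    F.toUnder d s hs = G.toUnder d t ht := by
  subst e
  obtain rfl : s = t := funext fun a => by simpa using h a
  rfl

/-- The pushout of contractible groupoids along a nonempty strongly connected category is
contractible. -/
lemma _root_.CategoryTheory.IsPushout.subsingleton_hom {A B C D : Cat.{u, u}} {f : A ⟶ B}
    {g : A ⟶ C} {k : B ⟶ D} {l : C ⟶ D} (h : IsPushout f g k l) (hD : IsGroupoid D)
    (hA : Nonempty A) (hA' : ∀ x y : A, Nonempty (x ⟶ y))
    (hB : ∀ x y : B, Nonempty (x ⟶ y)) (hB' : ∀ x y : B, Subsingleton (x ⟶ y))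
    (hC : ∀ x y : C, Nonempty (x ⟶ y)) (hC' : ∀ x y : C, Subsingleton (x ⟶ y)) (x y : D) :
    Subsingleton (x ⟶ y) := by
  obtain ⟨a⟩ := hA
  have w : f.toFunctor ⋙ k.toFunctor = g.toFunctor ⋙ l.toFunctor :=
    congrArg Cat.Hom.toFunctor h.w
  have e : k.toFunctor.obj (f.toFunctor.obj a) = l.toFunctor.obj (g.toFunctor.obj a) :=
    Functor.congr_obj w a
  let d := k.toFunctor.obj (f.toFunctor.obj a)
  -- Uniqueness of morphisms in `B` and in `C` makes these compatible families of paths from the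
  -- basepoint `d`, hence lifts of `k` and `l` to `Under d`.
  let s (b : B) : d ⟶ k.toFunctor.obj b := k.toFunctor.map (hB _ b).some
  let t (c : C) : d ⟶ l.toFunctor.obj c := eqToHom e ≫ l.toFunctor.map (hC _ c).some
  have hs {b b' : B} (m : b ⟶ b') : s b ≫ k.toFunctor.map m = s b' := by
    rw [← k.toFunctor.map_comp]
    exact congrArg k.toFunctor.map ((hB' _ _).elim _ _)
  have ht {c c' : C} (m : c ⟶ c') : t c ≫ l.toFunctor.map m = t c' := by
    rw [Category.assoc, ← l.toFunctor.map_comp]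
    exact congrArg (fun m => eqToHom e ≫ l.toFunctor.map m) ((hC' _ _).elim _ _)
  let S : B ⟶ Cat.of (Under d) := (k.toFunctor.toUnder d s hs).toCatHom
  let T : C ⟶ Cat.of (Under d) := (l.toFunctor.toUnder d t ht).toCatHom
  have hST : f ≫ S = g ≫ T := by
    apply Cat.ext
    refine toUnder_congr w d (fun a => s (f.toFunctor.obj a)) (fun m => hs (f.toFunctor.map m))
      (fun a => t (g.toFunctor.obj a)) (fun m => ht (g.toFunctor.map m)) fun a' => ?_
    -- Connectedness of `A` enters here: both paths from `d` to the image of `a'` come from the same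
    -- `m` in `A`, so the two lifts agree on `A`.
    obtain ⟨m⟩ := hA' a a'
    have hm := Functor.congr_hom w m
    have h₁ : s (f.toFunctor.obj a') = (f.toFunctor ⋙ k.toFunctor).map m :=
      congrArg k.toFunctor.map ((hB' _ _).elim _ _)
    have h₂ : t (g.toFunctor.obj a') = eqToHom e ≫ (g.toFunctor ⋙ l.toFunctor).map m :=
      congrArg (fun m => eqToHom e ≫ l.toFunctor.map m) ((hC' _ _).elim _ _)
    rw [h₁, h₂, hm]
    simp
  let R : D ⟶ Cat.of (Under d) := h.desc S T hST
  have hR : R ≫ (Under.forget d).toCatHom = 𝟙 D := by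
    apply h.hom_ext
    · rw [h.inl_desc_assoc]
      exact (Category.comp_id k).symm
    · rw [h.inr_desc_assoc]
      exact (Category.comp_id l).symm
  let R' : D ⥤ Under d := R.toFunctor
  have hR' : R' ⋙ Under.forget d = 𝟭 D := congrArg Cat.Hom.toFunctor hR
  refine ⟨fun m m' => ?_⟩
  -- The section `R'` of the forgetful functor gives each object a path from `d` that every morphism
  -- respects. In a groupoid this path can be cancelled, which determines the morphism.
  have key : (R'.map m).right = (R'.map m').right := by
    rw [← cancel_epi (R'.obj x).hom, Under.w, Under.w]
  have h₁ := Functor.congr_hom hR'.symm m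
  have h₂ := Functor.congr_hom hR'.symm m'
  change m = _ at h₁
  change m' = _ at h₂
  rw [h₁, h₂]
  simp only [Functor.comp_map, Under.forget_map, key]

/-- The shift by 2 makes the suspended sphere have dimension at least 1, hence be connected. -/
lemma IsSphere.weaklyEquivalent_terminal {n : ℕ} {S : Cat.{u, u}} (h : IsSphere (n + 2) S) :
    WeaklyEquivalent S (⊤_ Cat.{u, u}) := by
  have := h.nonempty
  have hS := h.nonempty_hom
  have hG := h.isGroupoid
  obtain ⟨Y, hY, X', Y', Z', f', g', pX, pY, pZ, k, l, -, -, -, hX, hpY, hpZ, -, -, hW⟩ := h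
  have := (weakEquivalence_iff_isEquivalence _).1 hX.2
  refine .rel _ _ ⟨terminal.from S, (isSurjectiveEquivalence_terminal_from hS
    (hW.subsingleton_hom hG ⟨pX.toFunctor.objPreimage hY.nonempty.some⟩
      (fun x y => (hY.nonempty_hom (pX.toFunctor.obj x) (pX.toFunctor.obj y)).map
        pX.toFunctor.preimage)
      (unique_hom_of_weakEquivalence_terminal hpZ.2).1
      (unique_hom_of_weakEquivalence_terminal hpZ.2).2
      (unique_hom_of_weakEquivalence_terminal hpY.2).1
      (unique_hom_of_weakEquivalence_terminal hpY.2).2) _).acyclicFibration.2⟩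

/-! ### Coproducts in `Cat` -/

/-- The disjoint union of categories as a cofan. -/
def sigmaCofan {I : Type u} (F : I → Cat.{u, u}) : Cofan F :=
  Cofan.mk (Cat.of (Σ i, F i)) fun i => (Sigma.incl (C := fun i => F i) i).toCatHom

/-- The disjoint union is the coproduct in `Cat`. -/
def isColimitSigmaCofan {I : Type u} (F : I → Cat.{u, u}) : IsColimit (sigmaCofan F) :=
  Cofan.IsColimit.mk _
    (fun s => (Sigma.desc (C := fun i => F i) fun i => (s.inj i).toFunctor).toCatHom)
    (fun _ _ => rfl)
    (fun s m hm => by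
      apply Cat.ext
      refine Functor.hext ?_ ?_
      · rintro ⟨i, x⟩
        exact Functor.congr_obj (congrArg Cat.Hom.toFunctor (hm i)) x
      · rintro ⟨i, x⟩ ⟨_, y⟩ ⟨f⟩
        exact Functor.hcongr_hom (congrArg Cat.Hom.toFunctor (hm i)) f)

/-- The coproduct in `Cat` is the disjoint union. -/
noncomputable def sigmaIso {I : Type u} (F : I → Cat.{u, u}) : ∐ F ≅ Cat.of (Σ i, F i) :=
  (coproductIsCoproduct F).coconePointUniqueUpToIso (isColimitSigmaCofan F)

/-- The disjoint union of functors. -/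
def sigmaFunctor {I : Type u} {F G : I → Cat.{u, u}} (φ : ∀ i, F i ⟶ G i) :
    Cat.of (Σ i, F i) ⟶ Cat.of (Σ i, G i) :=
  (Sigma.Functor.sigma (C := fun i => F i) (D := fun i => G i) fun i => (φ i).toFunctor).toCatHom

lemma ι_sigmaIso_hom {I : Type u} (F : I → Cat.{u, u}) (i : I) :
    Sigma.ι F i ≫ (sigmaIso F).hom = (Sigma.incl (C := fun i => F i) i).toCatHom :=
  (coproductIsCoproduct F).comp_coconePointUniqueUpToIso_hom (isColimitSigmaCofan F) ⟨i⟩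

lemma sigmaMap_eq {I : Type u} {F G : I → Cat.{u, u}} (φ : ∀ i, F i ⟶ G i) :
    Limits.Sigma.map φ = (sigmaIso F).hom ≫ sigmaFunctor φ ≫ (sigmaIso G).inv := by
  rw [← Category.assoc, Iso.eq_comp_inv]
  refine Sigma.hom_ext _ _ fun i => ?_
  rw [Sigma.ι_map_assoc, ι_sigmaIso_hom, ← Category.assoc, ι_sigmaIso_hom]
  rfl

lemma bijective_obj_sigmaMap {I : Type u} {F G : I → Cat.{u, u}} (φ : ∀ i, F i ⟶ G i)
    (h : ∀ i, Function.Bijective (φ i).toFunctor.obj) :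
    Function.Bijective (Limits.Sigma.map φ).toFunctor.obj := by
  have h' : Function.Bijective (sigmaFunctor φ).toFunctor.obj :=
    (Equiv.sigmaCongrRight fun i => Equiv.ofBijective _ (h i)).bijective
  rw [← isIso_objects_map_iff] at h' ⊢
  rw [sigmaMap_eq, Functor.map_comp, Functor.map_comp]
  infer_instance

lemma IsSurjectiveEquivalence.sigmaMap {I : Type u} {F G : I → Cat.{u, u}} {φ : ∀ i, F i ⟶ G i}
    (h : ∀ i, IsSurjectiveEquivalence (φ i)) :
    IsSurjectiveEquivalence (Limits.Sigma.map φ) := by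
  rw [sigmaMap_eq]
  refine (isSurjectiveEquivalence_of_isIso _).comp
    (.comp ⟨⟨?_⟩, ⟨?_⟩, ?_⟩ (isSurjectiveEquivalence_of_isIso _))
  · rintro ⟨i, x⟩ ⟨j, y⟩ (f : Sigma.SigmaHom (C := fun i => G i)
      ⟨i, (φ i).toFunctor.obj x⟩ ⟨j, (φ j).toFunctor.obj y⟩)
    obtain ⟨f⟩ := f
    obtain ⟨g, rfl⟩ := (h i).full.map_surjective f
    exact ⟨Sigma.SigmaHom.mk (C := fun i => F i) g, rfl⟩
  · rintro ⟨i, x⟩ ⟨_, y⟩ ⟨f⟩ ⟨g⟩ hfg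
    have := (h i).faithful
    have hfg' : Sigma.SigmaHom.mk (C := fun i => G i) ((φ i).toFunctor.map f) =
      Sigma.SigmaHom.mk (C := fun i => G i) ((φ i).toFunctor.map g) := hfg
    injection hfg' with _ _ _ hfg''
    exact congrArg (Sigma.SigmaHom.mk (C := fun i => F i))
      ((φ i).toFunctor.map_injective hfg'')
  · rintro ⟨i, y⟩
    obtain ⟨x, rfl⟩ := (h i).surjective y
    exact ⟨⟨i, x⟩, rfl⟩

/-! ### Discrete categories -/

lemma discrete_hom_ext {A : Type u} {B : Cat.{u, u}} {F G : Cat.of (Discrete A) ⟶ B}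
    (h : ∀ a, F.toFunctor.obj (Discrete.mk a) = G.toFunctor.obj (Discrete.mk a)) : F = G := by
  have key : ∀ F G : Discrete A ⥤ B, (∀ a, F.obj ⟨a⟩ = G.obj ⟨a⟩) → F = G := by
    refine fun F G h => Functor.hext (fun ⟨a⟩ => h a) ?_
    rintro ⟨a⟩ ⟨b⟩ f
    obtain rfl : a = b := Discrete.eq_of_hom f
    obtain rfl : f = 𝟙 _ := Subsingleton.elim _ _
    rw [F.map_id, G.map_id, h]
  exact Cat.ext (key _ _ h)

/-- The functor out of a discrete category given by a family of objects. -/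
def discreteHom {A : Type u} {B : Cat.{u, u}} (f : A → B) : Cat.of (Discrete A) ⟶ B :=
  (Discrete.functor f).toCatHom

lemma terminal_hom_ext {B : Cat.{u, u}} {F G : (⊤_ Cat.{u, u}) ⟶ B}
    (h : ∀ x, F.toFunctor.obj x = G.toFunctor.obj x) : F = G := by
  rw [← cancel_epi terminalIso.inv]
  exact discrete_hom_ext fun a => h _

/-- The point of a category given by an object. -/
noncomputable def point {B : Cat.{u, u}} (b : B) : (⊤_ Cat.{u, u}) ⟶ B :=
  terminalIso.hom ≫ discreteHom fun _ => b

/-- A discrete category is a coproduct of copies of the terminal category. -/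
noncomputable def isColimitDiscrete (A : Type u) :
    IsColimit (Cofan.mk (Cat.of (Discrete A)) fun a : A =>
      point (B := Cat.of (Discrete A)) (Discrete.mk a)) :=
  Cofan.IsColimit.mk _
    (fun s => discreteHom fun a => (s.inj a).toFunctor.obj nonempty_terminal.some)
    (fun s a => terminal_hom_ext fun _ =>
      congrArg (s.inj a).toFunctor.obj (subsingleton_terminal.elim _ _))
    (fun _ _ hm => discrete_hom_ext fun a =>
      Functor.congr_obj (congrArg Cat.Hom.toFunctor (hm a)) nonempty_terminal.some)

lemma isCWComplexOfDim_zero_discrete (A : Type u) :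
    IsCWComplexOfDim 0 (Cat.of (Discrete A)) :=
  ⟨isCofibrant _, A,
    ⟨(isColimitDiscrete A).coconePointUniqueUpToIso (coproductIsCoproduct _)⟩⟩

/-- The discrete category on two objects. -/
abbrev TwoPoints : Cat.{u, u} := Cat.of (Discrete (ULift.{u} Bool))

lemma isSphere_twoPoints : IsSphere 0 TwoPoints.{u} := by
  refine ⟨IsColimit.coconePointUniqueUpToIso (t := colimit.cocone (pair _ _))
    (s := BinaryCofan.mk (point (B := TwoPoints) (Discrete.mk ⟨false⟩))
      (point (B := TwoPoints) (Discrete.mk ⟨true⟩))) ?_ (colimit.isColimit _)⟩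
  refine BinaryCofan.IsColimit.mk _
    (fun F G => discreteHom fun b => bif b.down then G.toFunctor.obj nonempty_terminal.some
      else F.toFunctor.obj nonempty_terminal.some) ?_ ?_ ?_
  · exact fun F _ => terminal_hom_ext fun _ =>
      congrArg F.toFunctor.obj (subsingleton_terminal.elim _ _)
  · exact fun _ G => terminal_hom_ext fun _ =>
      congrArg G.toFunctor.obj (subsingleton_terminal.elim _ _)
  · rintro T F G m rfl rfl
    refine discrete_hom_ext ?_
    rintro ⟨_ | _⟩ <;> rfl

/-! ### The walking isomorphism -/

/-- The category with two objects and exactly one morphism between any two of them. -/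
abbrev WalkingIso : Cat.{u, u} := Cat.of (Chaotic (ULift.{u} Bool))

/-- The first endpoint of the walking isomorphism. -/
def WalkingIso.zero : WalkingIso.{u} := Chaotic.mk ⟨false⟩

/-- The second endpoint of the walking isomorphism. -/
def WalkingIso.one : WalkingIso.{u} := Chaotic.mk ⟨true⟩

/-- The generating morphism of the walking isomorphism. -/
def WalkingIso.hom : WalkingIso.zero.{u} ⟶ WalkingIso.one := PUnit.unit

/-- The inclusion of the endpoints of the walking isomorphism. -/
def endpoints : TwoPoints.{u} ⟶ WalkingIso.{u} := discreteHom fun b => Chaotic.mk b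

lemma bijective_obj_endpoints : Function.Bijective endpoints.{u}.toFunctor.obj :=
  ⟨fun ⟨_⟩ ⟨_⟩ h => congrArg Discrete.mk (congrArg Chaotic.as h), fun ⟨b⟩ => ⟨⟨b⟩, rfl⟩⟩

/-- The functor out of the walking isomorphism classifying a morphism of a groupoid. -/
noncomputable def classify {B : Cat.{u, u}} [IsGroupoid B] {x y : B} (f : x ⟶ y) :
    WalkingIso.{u} ⟶ B :=
  Functor.toCatHom (C := Chaotic (ULift.{u} Bool))
    { obj b := bif b.as.down then y else x
      map {b c} _ := match b, c with
        | ⟨⟨false⟩⟩, ⟨⟨false⟩⟩ => 𝟙 x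
        | ⟨⟨false⟩⟩, ⟨⟨true⟩⟩ => f
        | ⟨⟨true⟩⟩, ⟨⟨false⟩⟩ => inv f
        | ⟨⟨true⟩⟩, ⟨⟨true⟩⟩ => 𝟙 y
      map_id := by rintro ⟨⟨_ | _⟩⟩ <;> rfl
      map_comp := by
        rintro ⟨⟨_ | _⟩⟩ ⟨⟨_ | _⟩⟩ ⟨⟨_ | _⟩⟩ _ _ <;> simp }

lemma endpoints_comp_classify {B : Cat.{u, u}} [IsGroupoid B] {x y : B} (f : x ⟶ y) :
    endpoints ≫ classify f = discreteHom fun b => bif b.down then y else x :=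
  discrete_hom_ext fun _ => rfl

lemma classify_comp {B C : Cat.{u, u}} [IsGroupoid B] [IsGroupoid C] (F : B ⟶ C) {x y : B}
    (f : x ⟶ y) : classify f ≫ F = classify (F.toFunctor.map f) := by
  apply Cat.ext
  refine Functor.hext ?_ ?_
  · rintro ⟨⟨_ | _⟩⟩ <;> rfl
  · rintro ⟨⟨_ | _⟩⟩ ⟨⟨_ | _⟩⟩ _
    · exact heq_of_eq (F.toFunctor.map_id x)
    · rfl
    · exact heq_of_eq (F.toFunctor.map_inv f)
    · exact heq_of_eq (F.toFunctor.map_id y)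

/-! ### The circle -/

/-- The `1`-sphere given by two parallel isomorphisms. -/
noncomputable abbrev Circle : Cat.{u, u} := pushout endpoints.{u} endpoints.{u}

lemma isSphere_circle : IsSphere 1 Circle.{u} :=
  isSphere_twoPoints.succ_of_isPushout bijective_obj_endpoints.1 bijective_obj_endpoints.1
    (IsPushout.of_hasPushout _ _)

/-- The functor identifying the two parallel isomorphisms of the circle. -/
noncomputable def fold : Circle.{u} ⟶ WalkingIso.{u} := pushout.desc (𝟙 _) (𝟙 _) rfl

lemma bijective_obj_fold : Function.Bijective fold.{u}.toFunctor.obj := by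
  have h : IsIso (Cat.objects.map (pushout.inl endpoints.{u} endpoints.{u})) :=
    (isIso_objects_map_iff _).2
      ((IsPushout.of_hasPushout _ _).bijective_obj bijective_obj_endpoints)
  rw [← isIso_objects_map_iff]
  refine @IsIso.of_isIso_comp_left _ _ _ _ _ (Cat.objects.map (pushout.inl endpoints endpoints))
    _ h ?_
  rw [← Functor.map_comp, fold, pushout.inl_desc]
  infer_instance

/-- The functor out of the circle classifying a pair of parallel morphisms of a groupoid. -/
noncomputable def classifyPair {B : Cat.{u, u}} [IsGroupoid B] {x y : B} (f g : x ⟶ y) :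
    Circle.{u} ⟶ B :=
  pushout.desc (classify f) (classify g)
    ((endpoints_comp_classify f).trans (endpoints_comp_classify g).symm)

/-! ### Attaching cells along walking isomorphisms -/

/-- Gluing copies of the walking isomorphism along spheres with two objects attaches cells. -/
lemma attachesCells_of_isPushout {n : ℕ} {I : Type u} {S Y X : Cat.{u, u}} (hS : IsSphere n S)
    {i : S ⟶ WalkingIso} (hi : Function.Bijective i.toFunctor.obj)
    {f : (∐ fun _ : I => S) ⟶ Y} {j : Y ⟶ X} {l : (∐ fun _ : I => WalkingIso) ⟶ X}
    (h : IsPushout f (Limits.Sigma.map fun _ => i) j l) : AttachesCells n j := by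
  refine ⟨I, fun _ => S, f, fun _ => hS, isCofibrant _, _, Limits.Sigma.map fun _ => i,
    Limits.Sigma.map fun _ => terminal.from _, l,
    (cofibration_iff_injective _).2 (bijective_obj_sigmaMap _ fun _ => hi).1,
    (IsSurjectiveEquivalence.sigmaMap
      fun _ => isSurjectiveEquivalence_chaotic _ _).acyclicFibration, ?_, h⟩
  refine Sigma.hom_ext _ _ fun a => ?_
  rw [Sigma.ι_map_assoc, Sigma.ι_map, Sigma.ι_map, ← Category.assoc]
  exact congrArg (· ≫ _) (Subsingleton.elim _ _)

/-- An empty family of cells is attached. This lets a complex be regarded as one of any higher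
dimension. -/
lemma attachesCells_id (n : ℕ) (X : Cat.{u, u}) : AttachesCells n (𝟙 X) := by
  obtain ⟨S, hS⟩ := exists_isSphere.{u} n
  let i (F G : PEmpty.{u + 1} → Cat.{u, u}) : (∐ F) ⟶ (∐ G) :=
    Limits.Sigma.map fun i => i.elim
  have hi (F G : PEmpty.{u + 1} → Cat.{u, u}) : i F G ≫ i G F = 𝟙 _ :=
    Sigma.hom_ext _ _ fun a => a.elim
  have (F G : PEmpty.{u + 1} → Cat.{u, u}) : IsIso (i F G) := ⟨i G F, hi _ _, hi _ _⟩
  refine ⟨PEmpty, fun _ => S, Sigma.desc fun a => a.elim, fun _ => hS, isCofibrant _,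
    _, i _ _, 𝟙 _, Sigma.desc fun a => a.elim,
    (cofibration_iff_injective _).2 (bijective_obj_of_isIso _).1,
    (isSurjectiveEquivalence_of_isIso _).acyclicFibration,
    Sigma.hom_ext _ _ fun a => a.elim,
    IsPushout.of_vert_isIso ⟨Sigma.hom_ext _ _ fun a => a.elim⟩⟩

/-! ### Quotients of categories -/

section Descent

variable {A B C : Cat.{u, u}} {p : A ⟶ B}

lemma hom_ext_of_full_of_surjective [p.toFunctor.Full] (hp : Function.Surjective p.toFunctor.obj)
    {d d' : B ⟶ C} (h : p ≫ d = p ≫ d') : d = d' := by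
  have h' := congrArg Cat.Hom.toFunctor h
  apply Cat.ext
  refine Functor.hext (fun b => ?_) fun b b' g => ?_
  · obtain ⟨a, rfl⟩ := hp b
    exact Functor.congr_obj h' a
  · obtain ⟨a, rfl⟩ := hp b
    obtain ⟨a', rfl⟩ := hp b'
    obtain ⟨f, rfl⟩ := p.toFunctor.map_surjective g
    exact Functor.hcongr_hom h' f

/-- A full functor which is bijective on objects is the quotient of its source by the congruence
it induces. -/
lemma exists_descent_of_full_of_bijective [p.toFunctor.Full]
    (hp : Function.Bijective p.toFunctor.obj) (h : A ⟶ C)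
    (hh : ∀ {x y : A} (f g : x ⟶ y), p.toFunctor.map f = p.toFunctor.map g →
      h.toFunctor.map f = h.toFunctor.map g) : ∃ d : B ⟶ C, p ≫ d = h := by
  let e := Equiv.ofBijective _ hp
  have he (b : B) : p.toFunctor.obj (e.symm b) = b := e.apply_symm_apply b
  have he' (a : A) : e.symm (p.toFunctor.obj a) = a := e.symm_apply_apply a
  -- The chosen preimages need not be functorial, but they become so under `p`, which by `hh`
  -- suffices after applying `h`.
  let lift {b b' : B} (g : b ⟶ b') : e.symm b ⟶ e.symm b' :=
    p.toFunctor.preimage (eqToHom (he b) ≫ g ≫ eqToHom (he b').symm)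
  have hl {b b' : B} (g : b ⟶ b') :
      p.toFunctor.map (lift g) = eqToHom (he b) ≫ g ≫ eqToHom (he b').symm :=
    p.toFunctor.map_preimage _
  let d : B ⥤ C :=
    { obj b := h.toFunctor.obj (e.symm b)
      map g := h.toFunctor.map (lift g)
      map_id b := by
        rw [← h.toFunctor.map_id]
        exact hh _ _ (by rw [hl]; simp)
      map_comp g g' := by
        rw [← h.toFunctor.map_comp]
        exact hh _ _ (by rw [p.toFunctor.map_comp, hl, hl, hl]; simp) }
  have key {x y x' y' : A} (hx : x = x') (hy : y = y') (f : x ⟶ y) (f' : x' ⟶ y')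
      (hf : HEq (p.toFunctor.map f) (p.toFunctor.map f')) :
      HEq (h.toFunctor.map f) (h.toFunctor.map f') := by
    subst hx hy
    exact heq_of_eq (hh _ _ (eq_of_heq hf))
  refine ⟨d.toCatHom, Cat.ext (Functor.hext (fun a => congrArg h.toFunctor.obj (he' a)) ?_)⟩
  intro a a' f
  refine key (he' a) (he' a') _ _ ?_
  rw [hl]
  simp

end Descent

/-! ### Groupoids are two-dimensional CW-complexes -/

section Groupoid

variable (X : Cat.{u, u})

/-- The attaching map of one edge for each morphism of `X`. -/
noncomputable def edgeAttachment :
    (∐ fun _ : (Σ x y : X, x ⟶ y) => TwoPoints.{u}) ⟶ Cat.of (Discrete X) :=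
  Sigma.desc fun a => discreteHom fun b =>
    bif b.down then (Discrete.mk a.2.1 : Discrete X) else (Discrete.mk a.1 : Discrete X)

/-- The inclusion of the endpoints of the edges. -/
noncomputable def edgeEndpoints :
    (∐ fun _ : (Σ x y : X, x ⟶ y) => TwoPoints.{u}) ⟶
      ∐ fun _ : (Σ x y : X, x ⟶ y) => WalkingIso.{u} :=
  Limits.Sigma.map fun _ => endpoints

/-- The free groupoid on the morphisms of `X`. -/
noncomputable abbrev FreeOn : Cat.{u, u} := pushout (edgeAttachment X) (edgeEndpoints X)

lemma attachesCells_freeOn :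
    AttachesCells 0 (pushout.inl (edgeAttachment X) (edgeEndpoints X)) :=
  attachesCells_of_isPushout isSphere_twoPoints bijective_obj_endpoints
    (IsPushout.of_hasPushout _ _)

lemma isCWComplexOfDim_freeOn : IsCWComplexOfDim 1 (FreeOn X) :=
  ⟨_, _, isCWComplexOfDim_zero_discrete X, attachesCells_freeOn X⟩

instance : IsGroupoid (FreeOn X) := (isCWComplexOfDim_freeOn X).isGroupoid

variable [IsGroupoid X]

/-- The evaluation of formal composites in `X`. -/
noncomputable def evaluation : FreeOn X ⟶ X :=
  pushout.desc (discreteHom id) (Sigma.desc fun a => classify a.2.2) (by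
    refine Sigma.hom_ext _ _ fun a => ?_
    rw [edgeAttachment, edgeEndpoints, Sigma.ι_desc_assoc, Sigma.ι_map_assoc, Sigma.ι_desc,
      endpoints_comp_classify]
    refine discrete_hom_ext ?_
    rintro ⟨_ | _⟩ <;> rfl)

/-- Attaching edges leaves the objects of the discrete category unchanged, and on these evaluation
is the identity. -/
lemma bijective_obj_evaluation : Function.Bijective (evaluation X).toFunctor.obj := by
  have h : IsIso (Cat.objects.map (pushout.inl (edgeAttachment X) (edgeEndpoints X))) :=
    (isIso_objects_map_iff _).2 ((IsPushout.of_hasPushout _ _).bijective_obj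
      (bijective_obj_sigmaMap _ fun _ => bijective_obj_endpoints))
  rw [← isIso_objects_map_iff]
  refine @IsIso.of_isIso_comp_left _ _ _ _ _
    (Cat.objects.map (pushout.inl (edgeAttachment X) (edgeEndpoints X))) _ h ?_
  rw [← Functor.map_comp, evaluation, pushout.inl_desc, isIso_objects_map_iff]
  exact ⟨fun ⟨_⟩ ⟨_⟩ h => congrArg Discrete.mk h, fun x => ⟨Discrete.mk x, rfl⟩⟩

/-- The edge of the free groupoid on `X` given by a morphism of `X`. -/
noncomputable def edge {x y : X} (f : x ⟶ y) : WalkingIso.{u} ⟶ FreeOn X :=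
  Sigma.ι (fun _ : (Σ x y : X, x ⟶ y) => WalkingIso.{u}) ⟨x, y, f⟩ ≫ pushout.inr _ _

lemma edge_evaluation {x y : X} (f : x ⟶ y) : edge X f ≫ evaluation X = classify f := by
  rw [edge, evaluation, Category.assoc, pushout.inr_desc, Sigma.ι_desc]

instance full_evaluation : (evaluation X).toFunctor.Full where
  map_surjective {x y} g := by
    -- The preimage of `g` is the generator attached for `g`. Injectivity on objects places its
    -- endpoints at `x` and `y`.
    have w := congrArg Cat.Hom.toFunctor (edge_evaluation X g)
    have hx : (edge X g).toFunctor.obj WalkingIso.zero = x :=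
      (bijective_obj_evaluation X).1 (Functor.congr_obj w WalkingIso.zero)
    have hy : (edge X g).toFunctor.obj WalkingIso.one = y :=
      (bijective_obj_evaluation X).1 (Functor.congr_obj w WalkingIso.one)
    have hm := Functor.hcongr_hom w WalkingIso.hom
    have key {a b x y : FreeOn X} (hx : a = x) (hy : b = y) (m : a ⟶ b)
        (g : (evaluation X).toFunctor.obj x ⟶ (evaluation X).toFunctor.obj y)
        (hm : HEq ((evaluation X).toFunctor.map m) g) :
        ∃ f : x ⟶ y, (evaluation X).toFunctor.map f = g := by
      subst hx hy
      exact ⟨m, eq_of_heq hm⟩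
    exact key hx hy _ g hm

/-- The pairs of parallel morphisms of the free groupoid on `X` that become equal in `X`. -/
structure Relator : Type u where
  /-- The source. -/
  src : FreeOn X
  /-- The target. -/
  tgt : FreeOn X
  /-- The first morphism. -/
  fst : src ⟶ tgt
  /-- The second morphism. -/
  snd : src ⟶ tgt
  /-- The two morphisms become equal in `X`. -/
  eq : (evaluation X).toFunctor.map fst = (evaluation X).toFunctor.map snd

/-- A groupoid is obtained from the free groupoid on its morphisms by identifying those parallel
pairs which become equal. -/
lemma isPushout_evaluation :
    IsPushout (Sigma.desc fun r : Relator X => classifyPair r.fst r.snd)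
      (Limits.Sigma.map fun _ : Relator X => fold) (evaluation X)
      (Sigma.desc fun r : Relator X => classify r.fst ≫ evaluation X) := by
  have hw (r : Relator X) :
      classify r.snd ≫ evaluation X = classify r.fst ≫ evaluation X := by
    rw [classify_comp, classify_comp, r.eq]
  refine ⟨⟨Sigma.hom_ext _ _ fun r => ?_⟩, ⟨PushoutCocone.isColimitAux' _ fun s => ?_⟩⟩
  · rw [Sigma.ι_desc_assoc, Sigma.ι_map_assoc, Sigma.ι_desc]
    apply pushout.hom_ext
    · simp only [classifyPair, fold, pushout.inl_desc_assoc, Category.id_comp]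
    · simp only [classifyPair, fold, pushout.inr_desc_assoc, Category.id_comp, hw]
  · have hs (r : Relator X) : classifyPair r.fst r.snd ≫ s.inl =
        fold ≫ Sigma.ι (fun _ : Relator X => WalkingIso.{u}) r ≫ s.inr := by
      have := congrArg (Sigma.ι (fun _ : Relator X => Circle.{u}) r ≫ ·) s.condition
      simpa only [Sigma.ι_desc_assoc, Sigma.ι_map_assoc] using this
    have h₁ (r : Relator X) : classify r.fst ≫ s.inl =
        Sigma.ι (fun _ : Relator X => WalkingIso.{u}) r ≫ s.inr := by
      have := congrArg (pushout.inl _ _ ≫ ·) (hs r)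
      simpa only [classifyPair, fold, pushout.inl_desc_assoc, Category.id_comp] using this
    have h₂ (r : Relator X) : classify r.snd ≫ s.inl =
        Sigma.ι (fun _ : Relator X => WalkingIso.{u}) r ≫ s.inr := by
      have := congrArg (pushout.inr _ _ ≫ ·) (hs r)
      simpa only [classifyPair, fold, pushout.inr_desc_assoc, Category.id_comp] using this
    -- Two morphisms with equal image in `X` are themselves a `Relator`, and the 2-cell of that
    -- relator forces `s.inl` to identify them.
    have hd := exists_descent_of_full_of_bijective (bijective_obj_evaluation X) s.inl
      fun f g hfg => eq_of_heq (Functor.hcongr_hom (congrArg Cat.Hom.toFunctor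
        ((h₁ ⟨_, _, f, g, hfg⟩).trans (h₂ ⟨_, _, f, g, hfg⟩).symm)) WalkingIso.hom)
    refine ⟨hd.choose, hd.choose_spec, Sigma.hom_ext _ _ fun r => ?_, fun {m} hm _ => ?_⟩
    · exact (Sigma.ι_desc_assoc _ _ _).trans <| (Category.assoc _ _ _).trans <|
        (congrArg (classify r.fst ≫ ·) hd.choose_spec).trans (h₁ r)
    · exact hom_ext_of_full_of_surjective (bijective_obj_evaluation X).2
        (hm.trans hd.choose_spec.symm)

/-- `fold` plays the part of the cofibration from the circle into a contractible replacement of the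
point, being bijective on objects. -/
lemma attachesCells_evaluation : AttachesCells 1 (evaluation X) :=
  attachesCells_of_isPushout isSphere_circle bijective_obj_fold (isPushout_evaluation X)

lemma isCWComplexOfDim_of_isGroupoid (n : ℕ) : IsCWComplexOfDim (n + 2) X := by
  induction n with
  | zero => exact ⟨_, _, isCWComplexOfDim_freeOn X, attachesCells_evaluation X⟩
  | succ n ih => exact ⟨_, _, ih, attachesCells_id _ _⟩

/-- The skeleta of a groupoid. -/
noncomputable def skeleton : ℕ → Cat.{u, u}
  | 0 => Cat.of (Discrete X)
  | 1 => FreeOn X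
  | _ + 2 => X

/-- The inclusions of the skeleta of a groupoid. -/
noncomputable def skeletonMap : ∀ n, skeleton X n ⟶ skeleton X (n + 1)
  | 0 => pushout.inl (edgeAttachment X) (edgeEndpoints X)
  | 1 => evaluation X
  | _ + 2 => 𝟙 X

lemma isCWComplexOfDim_skeleton : ∀ n, IsCWComplexOfDim n (skeleton X n)
  | 0 => isCWComplexOfDim_zero_discrete X
  | 1 => isCWComplexOfDim_freeOn X
  | n + 2 => isCWComplexOfDim_of_isGroupoid X n

lemma attachesCells_skeletonMap : ∀ n, AttachesCells n (skeletonMap X n)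
  | 0 => attachesCells_freeOn X
  | 1 => attachesCells_evaluation X
  | n + 2 => attachesCells_id (n + 2) X

lemma isEventuallyConstantFrom_skeleton :
    (Functor.ofSequence (skeletonMap X)).IsEventuallyConstantFrom 2 := by
  intro j f
  obtain ⟨k, rfl⟩ := Nat.exists_eq_add_of_le (leOfHom f)
  obtain rfl := Subsingleton.elim f (homOfLE (Nat.le_add_right 2 k))
  induction k with
  | zero => exact inferInstanceAs (IsIso ((Functor.ofSequence (skeletonMap X)).map (𝟙 2)))
  | succ k ih =>
    have h : IsIso ((Functor.ofSequence (skeletonMap X)).map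
        (homOfLE (Nat.le_add_right (2 + k) 1))) := by
      -- With the index in the form `k + 2`, `skeletonMap` unfolds to the identity of `X`.
      rw [Functor.ofSequence_map_homOfLE_succ, Nat.add_comm 2 k]
      exact inferInstanceAs (IsIso (𝟙 X))
    rw [← homOfLE_comp (Nat.le_add_right 2 k) (Nat.le_add_right (2 + k) 1), Functor.map_comp]
    infer_instance

lemma isCWComplex_of_isGroupoid : IsCWComplex X := by
  refine ⟨isCofibrant X, Functor.ofSequence (skeletonMap X), isCWComplexOfDim_skeleton X,
    fun n => ⟨isCWComplexOfDim_skeleton X n, ?_⟩, ?_⟩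
  · rw [Functor.ofSequence_map_homOfLE_succ]
    exact attachesCells_skeletonMap X n
  · have := (isEventuallyConstantFrom_skeleton X).isIso_ι_of_isColimit (colimit.isColimit _)
    exact .rel _ _ ⟨_, weakEquivalence_of_isIso
      ((colimit.cocone (Functor.ofSequence (skeletonMap X))).ι.app 2)⟩

end Groupoid

end FormalCW

theorem mainTheorem3 :
    -- a small category is weakly equivalent to a CW-complex iff it is a groupoid
    (∀ X : Cat.{u, u},
      (∃ K : Cat.{u, u}, FormalCW.IsCWComplex K ∧ FormalCW.WeaklyEquivalent X K) ↔
        IsGroupoid X) ∧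
    -- the same with finite-dimensional CW-complexes
    (∀ X : Cat.{u, u},
      (∃ K : Cat.{u, u}, FormalCW.IsFiniteDimCWComplex K ∧ FormalCW.WeaklyEquivalent X K) ↔
        IsGroupoid X) ∧
    -- every CW-complex is weakly equivalent to a 2-dimensional one
    (∀ K : Cat.{u, u}, FormalCW.IsCWComplex K ∨ FormalCW.IsFiniteDimCWComplex K →
      ∃ L : Cat.{u, u}, FormalCW.IsCWComplexOfDim 2 L ∧ FormalCW.WeaklyEquivalent K L) ∧
    -- in each dimension at least 2, spheres exist, and all of them are contractible
    (∀ n : ℕ, 2 ≤ n →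
      (∃ S : Cat.{u, u}, FormalCW.IsSphere n S) ∧
      ∀ S : Cat.{u, u}, FormalCW.IsSphere n S →
        FormalCW.WeaklyEquivalent S (⊤_ Cat.{u, u})) := by
  refine ⟨fun X => ⟨?_, fun h => ⟨X, FormalCW.isCWComplex_of_isGroupoid X, .refl X⟩⟩,
    fun X => ⟨?_, fun h => ⟨X, ⟨2, FormalCW.isCWComplexOfDim_of_isGroupoid X 0⟩, .refl X⟩⟩,
    fun K hK => ?_, fun n hn => ⟨FormalCW.exists_isSphere n, fun S hS => ?_⟩⟩
  · rintro ⟨K, hK, hX⟩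
    exact hX.isGroupoid_iff.2 hK.isGroupoid
  · rintro ⟨K, ⟨n, hK⟩, hX⟩
    exact hX.isGroupoid_iff.2 hK.isGroupoid
  · have : IsGroupoid K := by
      rcases hK with hK | ⟨n, hK⟩
      · exact hK.isGroupoid
      · exact hK.isGroupoid
    exact ⟨K, FormalCW.isCWComplexOfDim_of_isGroupoid K 0, .refl K⟩
  · obtain ⟨m, rfl⟩ := Nat.exists_eq_add_of_le' hn
    exact hS.weaklyEquivalent_terminal
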